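/- All posets are finite, and the empty poset is allowed. A poset $P$ is $(3+1)$-free if there are no $a<b<c$ and $d$ in $P$ with $d$ incomparable to each of $a,b,c$. For $a\in P$ let $D_a=\{x : x<a\}$ and $U_a=\{x : x>a\}$. Two vertices $a,b$ are clones if $D_a=D_b$ and $U_a=U_b$. A top (respectively bottom) of a tangle is a connected component with at least two vertices of the graph on $P$ joining $a$ and $b$ whenever $D_a,D_b$ (respectively $U_a,U_b$) are incomparable under inclusion. A tangle is a pair $(A,B)$ of a top of a tangle $A$ and a bottom of a tangle $B$ such that some induced $(2+2)$ subposet of $P$ has its two top vertices in $A$ and its two bottom vertices in $B$. A clone set is an equivalence class, under the clone relation, of the vertices that lie in no tangle. The levels of $P$ are defined by letting $L_1$ be the set of minimal vertices of $P$ and $L_{k+1}$ the set of minimal vertices of $P\setminus(L_1\cup\dots\cup L_k)$; write $\ell(a)=k$ if $a\in L_k$. A compatible listing of $P$ is a listing $(X_1,\dots,X_n)$, without repetition, of all clone sets and tangles of $P$ such that for all $i\ne j$ and all vertices $a$ in $X_i$ and $b$ in $X_j$, one has $a<b$ if and only if $\ell(a)\le\ell(b)-2$, or $\ell(a)=\ell(b)-1$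 and $i<j$. Let $\Sigma=\{c_i : i\ge 1\}\cup\{t_{i\,i+1} : i\ge 1\}$, and let $M$ be the free partially commutative monoid on $\Sigma$ with relations $c_ic_j=c_jc_i$ if $|i-j|\ge 2$; $c_it_{j\,j+1}=t_{j\,j+1}c_i$ if $i\le j-2$ or $i\ge j+3$; and $t_{i\,i+1}t_{j\,j+1}=t_{j\,j+1}t_{i\,i+1}$ if $|i-j|\ge 3$. A representative of $m\in M$ is a word $w\in\Sigma^*$ whose image in $M$ is $m$. Each compatible listing of $P$ gives a word in $\Sigma^*$, by replacing each clone set contained in level $L_i$ by $c_i$ and each tangle with bottom contained in $L_i$ and top contained in $L_{i+1}$ by $t_{i\,i+1}$. The skeleton of a $(3+1)$-free poset $P$ is the element $m\in M$ whose representatives are exactly the words obtained in this way from the compatible listings of $P$. **Theorem.** Let $m$ be an element of $M$. Then $m$ is the skeleton of some finite $(3+1)$-free poset if and only if (i) every non-empty representative $w\in\Sigma^*$ of $m$ starts with the letter $c_1$ or $t_{12}$; and (ii) no representative $w\in\Sigma^*$ of $m$ contains a factor of the form $c_ic_i$, $i\ge 1$. -/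

import Mathlib

universe u

namespace Skeleta

/-! ### Posets, views and tangles -/

section Poset

variable (P : Type u) [PartialOrder P]

/-- `P` is `(3+1)`-free: there are no `a < b < c` and `d` with `d` incomparable to all of them. -/
def ThreeOneFree : Prop :=
  ¬ ∃ a b c d : P, a < b ∧ b < c ∧
    IncompRel (· ≤ ·) d a ∧ IncompRel (· ≤ ·) d b ∧ IncompRel (· ≤ ·) d c

variable {P}

/-- The view from `a`: the strict downset of `a` and the complement of its strict upset. -/
def view (a : P) : Set P × Set P := (Set.Iio a, (Set.Ioi a)ᶜ)

/-- Two vertices are clones if they have the same view. -/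
def Clones (a b : P) : Prop := view a = view b

variable (P)

/-- The graph joining `a` and `b` when their strict downsets are incomparable under inclusion. -/
def topGraph : SimpleGraph P where
  Adj a b := ¬ Set.Iio a ⊆ Set.Iio b ∧ ¬ Set.Iio b ⊆ Set.Iio a
  symm := ⟨fun _ _ h => ⟨h.2, h.1⟩⟩
  loopless := ⟨fun _ h => h.1 subset_rfl⟩

/-- The graph joining `a` and `b` when their strict upsets are incomparable under inclusion. -/
def botGraph : SimpleGraph P where
  Adj a b := ¬ Set.Ioi a ⊆ Set.Ioi b ∧ ¬ Set.Ioi b ⊆ Set.Ioi a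
  symm := ⟨fun _ _ h => ⟨h.2, h.1⟩⟩
  loopless := ⟨fun _ h => h.1 subset_rfl⟩

variable {P}

/-- A top of a tangle: a connected component of `topGraph P` with at least two vertices. -/
def IsTangleTop (A : Set P) : Prop :=
  A.Nontrivial ∧ ∃ K : (topGraph P).ConnectedComponent, K.supp = A

/-- A bottom of a tangle: a connected component of `botGraph P` with at least two vertices. -/
def IsTangleBot (B : Set P) : Prop :=
  B.Nontrivial ∧ ∃ K : (botGraph P).ConnectedComponent, K.supp = B

/-- Some induced `(2+2)` subposet has its two top vertices in `A` and its two bottom vertices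
in `B`. -/
def Matched (A B : Set P) : Prop :=
  ∃ a ∈ A, ∃ a' ∈ A, ∃ b ∈ B, ∃ b' ∈ B, b < a ∧ b' < a' ∧
    IncompRel (· ≤ ·) a a' ∧ IncompRel (· ≤ ·) b b' ∧
    IncompRel (· ≤ ·) a b' ∧ IncompRel (· ≤ ·) a' b

/-- A tangle: a matched pair of a top of a tangle and a bottom of a tangle. -/
def IsTangle (A B : Set P) : Prop := IsTangleTop A ∧ IsTangleBot B ∧ Matched A B

variable (P)

/-- The vertices lying in no tangle. -/
def outsideTangles : Set P := {x | ∀ A B : Set P, IsTangle A B → x ∉ A ∪ B}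

variable {P}

/-- A clone set: a class, under the clone relation, of the vertices lying in no tangle. -/
def IsCloneSet (C : Set P) : Prop :=
  ∃ a ∈ outsideTangles P, C = {x | x ∈ outsideTangles P ∧ Clones x a}

variable (P)

/-- Candidates for parts: one set of vertices, or a pair (top, bottom) of sets of vertices. -/
inductive Part : Type u
  | cloneSet (C : Set P) : Part
  | tangle (A B : Set P) : Part

variable {P}

/-- The genuine parts of `P` are its clone sets and its tangles. -/
def Part.IsPart : Part P → Prop
  | .cloneSet C => IsCloneSet C
  | .tangle A B => IsTangle A B

/-- The set of all vertices of a part. -/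
def Part.verts : Part P → Set P
  | .cloneSet C => C
  | .tangle A B => A ∪ B

/-! ### Levels and compatible listings -/

variable (P)

/-- The union `L₁ ∪ ⋯ ∪ Lₖ` of the first `k` levels of `P`, where `Lₖ₊₁` is the set of minimal
vertices of `P ∖ (L₁ ∪ ⋯ ∪ Lₖ)`. -/
def firstLevels : ℕ → Set P
  | 0 => ∅
  | k + 1 => firstLevels k ∪ {a | Minimal (fun x => x ∉ firstLevels k) a}

variable {P}

/-- The level of a vertex (so minimal vertices have level `1`): the first `k` such that the
vertex lies in `L₁ ∪ ⋯ ∪ Lₖ`. In a finite poset every vertex has a level. -/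
noncomputable def level (a : P) : ℕ := sInf {k | a ∈ firstLevels P k}

/-- A listing, without repetition, of all clone sets and tangles of `P`, such that vertices
`a, b` in different parts satisfy `a < b` exactly when `level a ≤ level b - 2`, or
`level a = level b - 1` and the part of `a` comes before the part of `b`. -/
def IsCompatibleListing (X : List (Part P)) : Prop :=
  X.Nodup ∧ (∀ Y : Part P, Y ∈ X ↔ Y.IsPart) ∧
    ∀ i j : Fin X.length, i ≠ j → ∀ a ∈ (X.get i).verts, ∀ b ∈ (X.get j).verts,
      (a < b ↔ level a + 2 ≤ level b ∨ (level a + 1 = level b ∧ i < j))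

end Poset

/-! ### The partially commutative monoid -/

/-- The alphabet: the letters `c i` and the letters `t i` (standing for `t_{i,i+1}`), `i ≥ 1`. -/
inductive Letter : Type
  | c (i : ℕ+) : Letter
  | t (i : ℕ+) : Letter

/-- The defining commutation relations. -/
inductive CommRel : FreeMonoid Letter → FreeMonoid Letter → Prop
  | cc (i j : ℕ+) (h : (i : ℕ) + 2 ≤ j ∨ (j : ℕ) + 2 ≤ i) :
      CommRel (.of (.c i) * .of (.c j)) (.of (.c j) * .of (.c i))
  | ct (i j : ℕ+) (h : (i : ℕ) + 2 ≤ j ∨ (j : ℕ) + 3 ≤ i) :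
      CommRel (.of (.c i) * .of (.t j)) (.of (.t j) * .of (.c i))
  | tt (i j : ℕ+) (h : (i : ℕ) + 3 ≤ j ∨ (j : ℕ) + 3 ≤ i) :
      CommRel (.of (.t i) * .of (.t j)) (.of (.t j) * .of (.t i))

/-- The free partially commutative monoid on the alphabet with these relations. -/
abbrev M : Type := PresentedMonoid CommRel

/-- The word `w` is a representative of the element `m` of `M`. -/
def Represents (w : FreeMonoid Letter) (m : M) : Prop := PresentedMonoid.mk CommRel w = m

/-! ### Skeleta -/

section Skeleton

variable {P : Type u} [PartialOrder P]

/-- A clone set at level `i` is given the letter `c i`, and a tangle straddling the levels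
`i, i + 1` is given the letter `t i`. -/
def HasLetter : Part P → Letter → Prop
  | .cloneSet C, .c i => ∀ a ∈ C, level a = i
  | .tangle A B, .t i => (∀ b ∈ B, level b = i) ∧ ∀ a ∈ A, level a = i + 1
  | _, _ => False

variable (P)

/-- `w` is obtained from some compatible listing of `P` by replacing each part by its letter. -/
def IsListingWord (w : FreeMonoid Letter) : Prop :=
  ∃ X : List (Part P), IsCompatibleListing X ∧ List.Forall₂ HasLetter X w.toList

/-- `m` is the skeleton of `P`: the representatives of `m` are exactly the words obtained from
the compatible listings of `P`. -/
def IsSkeleton (m : M) : Prop :=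
  ∀ w : FreeMonoid Letter, Represents w m ↔ IsListingWord P w

end Skeleton

end Skeleta

/-! Two letters commute exactly when every level occupied by one differs by at least two from every
level occupied by the other (`Letter.Far`). Far parts satisfy the listing condition in either order,
so listing words are closed under commutation (`IsListingWord.of_mk_eq`). Conversely, any two
compatible listings of `P` give the same element of `M`: distinct parts that occur in both orders
must be far apart (`far_of_prec`), so one listing can be sorted into the other by commutations
(`trace_map_eq_of_pairwise`). Hence a single listing word of `P` determines its skeleton.

Necessity is read off listings. A first part whose lowest level exceeded 1 would have below it a
vertex one level down in a later part, which the listing condition forbids. Adjacent clone sets on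
one level could be exchanged, which makes their members clones, so the two sets would coincide.

For sufficiency, take any representative `L` and build a poset on it: a letter `c i` becomes one
vertex, a letter `t i` becomes a (2+2). Order is forced at level distance two; at distance one it
follows position in `L`, and inside a tangle a bottom lies below only the top on its own side. This
poset is always (3+1)-free, and its tangles are exactly the `t` positions. Condition (i) makes the
intended levels the true ones: otherwise some letter of index at least 2 could be moved to the front
(`exists_trace_eq_cons`). Condition (ii) makes distinct `c` positions distinct clone sets: otherwise
two equal letters `c i` could be made adjacent (`exists_trace_eq_append_cc`). So `L` itself is a
listing word. -/

namespace Skeleta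

/-! ### Words and traces -/

/-- The levels occupied by a part with a given letter. -/
def Letter.levels : Letter → Set ℕ
  | .c i => {(i : ℕ)}
  | .t i => {(i : ℕ), (i : ℕ) + 1}

/-- The lowest level occupied by a part with a given letter. -/
def Letter.idx : Letter → ℕ
  | .c i => i
  | .t i => i

/-- Two letters are far apart if any two levels they occupy differ by at least two. -/
def Letter.Far (x y : Letter) : Prop :=
  ∀ k ∈ x.levels, ∀ l ∈ y.levels, k + 2 ≤ l ∨ l + 2 ≤ k

theorem Letter.Far.symm {x y : Letter} (h : x.Far y) : y.Far x :=
  fun k hk l hl => (h l hl k hk).symm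

theorem Letter.idx_pos (x : Letter) : 1 ≤ x.idx := by
  cases x with
  | c i => exact i.pos
  | t i => exact i.pos

/-- The element of `M` represented by a list of letters. -/
def trace (l : List Letter) : M := PresentedMonoid.mk CommRel (FreeMonoid.ofList l)

theorem trace_append (l₁ l₂ : List Letter) : trace (l₁ ++ l₂) = trace l₁ * trace l₂ := by
  simp [trace]

theorem trace_cons (x : Letter) (l : List Letter) : trace (x :: l) = trace [x] * trace l :=
  trace_append [x] l

theorem trace_eq_of_commRel {l₁ l₂ : List Letter}
    (h : CommRel (FreeMonoid.ofList l₁) (FreeMonoid.ofList l₂)) : trace l₁ = trace l₂ :=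
  Quotient.sound (ConGen.Rel.of _ _ h)

theorem trace_pair_of_far {x y : Letter} (h : x.Far y) : trace [x, y] = trace [y, x] := by
  cases x with
  | c i =>
    cases y with
    | c j =>
      refine trace_eq_of_commRel (.cc i j ?_)
      have := h i rfl j rfl
      omega
    | t j =>
      refine trace_eq_of_commRel (.ct i j ?_)
      have h1 := h i rfl j (Or.inl rfl)
      have h2 := h i rfl (j + 1) (Or.inr rfl)
      omega
  | t i =>
    cases y with
    | c j =>
      refine (trace_eq_of_commRel (.ct j i ?_)).symm
      have h1 := h i (Or.inl rfl) j rfl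
      have h2 := h (i + 1) (Or.inr rfl) j rfl
      omega
    | t j =>
      refine trace_eq_of_commRel (.tt i j ?_)
      have h1 := h i (Or.inl rfl) j (Or.inl rfl)
      have h2 := h (i + 1) (Or.inr rfl) j (Or.inl rfl)
      have h3 := h i (Or.inl rfl) (j + 1) (Or.inr rfl)
      omega

theorem exists_far_of_commRel {a b : FreeMonoid Letter} (h : CommRel a b) :
    ∃ x y : Letter, x.Far y ∧ a = FreeMonoid.ofList [x, y] ∧ b = FreeMonoid.ofList [y, x] := by
  cases h with
  | cc i j h =>
    refine ⟨_, _, ?_, rfl, rfl⟩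
    rintro k rfl l rfl
    exact h
  | ct i j h =>
    refine ⟨_, _, ?_, rfl, rfl⟩
    rintro k rfl l (rfl | rfl) <;> omega
  | tt i j h =>
    refine ⟨_, _, ?_, rfl, rfl⟩
    rintro k (rfl | rfl) l (rfl | rfl) <;> omega

theorem trace_swap {x y : Letter} (h : x.Far y) (l : List Letter) :
    trace (x :: y :: l) = trace (y :: x :: l) := by
  have := congrArg (· * trace l) (trace_pair_of_far h)
  simpa only [← trace_append, List.cons_append, List.nil_append] using this

theorem trace_cons_congr {l l' : List Letter} (x : Letter) (h : trace l = trace l') :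
    trace (x :: l) = trace (x :: l') := by
  rw [trace_cons, h, ← trace_cons]

theorem trace_move_front {x : Letter} {l₁ : List Letter} (h : ∀ y ∈ l₁, x.Far y)
    (l₂ : List Letter) : trace (l₁ ++ x :: l₂) = trace (x :: (l₁ ++ l₂)) := by
  induction l₁ with
  | nil => rfl
  | cons y l₁ ih =>
    rw [List.cons_append, trace_cons_congr y (ih fun z hz => h z (by simp [hz])), List.cons_append]
    exact (trace_swap (h y (by simp)) _).symm

/-- If a letter on level at least `i` is preceded by no letter occupying level `i - 1`, then some
letter on level at least `i` can be moved to the front. -/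
theorem exists_trace_eq_cons {i : ℕ} {u : List Letter} {l : Letter} (hl : i ≤ l.idx)
    (hu : ∀ x ∈ u, ∀ k ∈ x.levels, k + 1 ≠ i) (v : List Letter) :
    ∃ l' v', i ≤ l'.idx ∧ trace (u ++ l :: v) = trace (l' :: v') := by
  induction u with
  | nil => exact ⟨l, v, hl, rfl⟩
  | cons x u ih =>
    by_cases hx : i ≤ x.idx
    · exact ⟨x, _, hx, rfl⟩
    · obtain ⟨l', v', hl', e⟩ := ih fun y hy => hu y (by simp [hy])
      refine ⟨l', x :: v', hl', ?_⟩
      rw [List.cons_append, trace_cons_congr x e]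
      refine trace_swap ?_ _
      -- Here `x` starts below `i` and misses level `i - 1`, so all its levels are at most `i - 2`,
      -- while those of `l'` are at least `i`.
      intro k hk k' hk'
      have hx' := hu x (by simp)
      left
      cases x with
      | c a =>
        have h1 := hx' a rfl
        cases l' with
        | c b => cases hk; cases hk'; simp only [Letter.idx] at *; omega
        | t b => cases hk; rcases hk' with rfl | rfl <;> simp only [Letter.idx] at * <;> omega
      | t a =>
        have h1 := hx' a (Or.inl rfl)
        have h2 := hx' (a + 1) (Or.inr rfl)
        cases l' with
        | c b => cases hk'; rcases hk with rfl | rfl <;> simp only [Letter.idx] at * <;> omega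
        | t b =>
          rcases hk with rfl | rfl <;> rcases hk' with rfl | rfl <;>
            simp only [Letter.idx] at * <;> omega

/-- Two letters `c i` separated only by letters not occupying the levels `i - 1` and `i + 1` can
be made adjacent. -/
theorem exists_trace_eq_append_cc {i : ℕ+} (mid v : List Letter)
    (h : ∀ x ∈ mid, ∀ k ∈ x.levels, k + 1 ≠ i ∧ k ≠ i + 1) :
    ∃ u' v', trace (.c i :: (mid ++ .c i :: v)) = trace (u' ++ (.c i :: .c i :: v')) := by
  induction mid with
  | nil => exact ⟨[], v, rfl⟩
  | cons x mid ih =>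
    by_cases hx : x = .c i
    · subst hx
      exact ⟨[], mid ++ .c i :: v, rfl⟩
    · obtain ⟨u', v', e⟩ := ih fun y hy => h y (by simp [hy])
      refine ⟨x :: u', v', ?_⟩
      -- A letter other than `c i` that avoids the levels `i ± 1` also avoids `i`, since a `t` on
      -- level `i` covers a neighbouring level; so `c i` can pass it.
      rw [List.cons_append, List.cons_append, ← trace_cons_congr x e]
      refine trace_swap ?_ _
      have hx' := h x (by simp)
      rintro _ rfl k hk
      cases x with
      | c j =>
        cases hk
        have h1 := hx' j rfl
        have h2 : (j : ℕ) ≠ i := fun e => hx (by rw [PNat.coe_injective e])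
        omega
      | t j =>
        have h1 := hx' j (Or.inl rfl)
        have h2 := hx' (j + 1) (Or.inr rfl)
        rcases hk with rfl | rfl <;> omega

/-! ### Levels and parts -/

section Poset

variable {P : Type u} [PartialOrder P]

theorem firstLevels_mono : Monotone (firstLevels P) :=
  monotone_nat_of_le_succ fun _ => Set.subset_union_left

theorem mem_firstLevels_level {a : P} (h : level a ≠ 0) : a ∈ firstLevels P (level a) :=
  Nat.sInf_mem (Nat.nonempty_of_sInf_eq_succ (Nat.succ_pred_eq_of_ne_zero h).symm)

theorem notMem_firstLevels {a : P} {k : ℕ} (h : k < level a) : a ∉ firstLevels P k :=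
  Nat.notMem_of_lt_sInf h

theorem level_eq_succ {a : P} {k : ℕ} (h : a ∈ firstLevels P (k + 1))
    (h' : a ∉ firstLevels P k) : level a = k + 1 := by
  have h1 : level a ≤ k + 1 := Nat.sInf_le h
  by_contra hne
  refine h' (firstLevels_mono (show level a ≤ k by omega) ?_)
  exact Nat.sInf_mem (s := {j : ℕ | a ∈ firstLevels P j}) ⟨k + 1, h⟩

/-- A vertex of level at least two has a vertex of the previous level below it. -/
theorem exists_lt_level_eq {a : P} (h : 2 ≤ level a) : ∃ x < a, level x + 1 = level a := by
  obtain ⟨k, hk⟩ : ∃ k, level a = k + 2 := ⟨level a - 2, by omega⟩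
  have h0 := notMem_firstLevels (a := a) (k := k) (by omega)
  have h1 := notMem_firstLevels (a := a) (k := k + 1) (by omega)
  have h2 := mem_firstLevels_level (a := a) (by omega)
  rw [hk] at h2
  have hmin : Minimal (fun x => x ∉ firstLevels P (k + 1)) a := h2.resolve_left h1
  have hnot : ¬ Minimal (fun x => x ∉ firstLevels P k) a := fun hm => h1 (Or.inr hm)
  obtain ⟨x, hx, hxk⟩ := (not_minimal_iff_exists_lt (P := fun x => x ∉ firstLevels P k) h0).1 hnot
  refine ⟨x, hx, ?_⟩
  have hx1 : x ∈ firstLevels P (k + 1) := by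
    by_contra hc
    exact hmin.not_lt hc hx
  rw [level_eq_succ hx1 hxk, hk]

/-- A positive, strictly monotone function that drops by exactly one somewhere below each vertex
is the level function. -/
theorem level_eq_of_rank (f : P → ℕ) (hpos : ∀ a, 1 ≤ f a) (hlt : ∀ a b, a < b → f a < f b)
    (hpred : ∀ a, 2 ≤ f a → ∃ b < a, f b + 1 = f a) (a : P) : level a = f a := by
  have key : ∀ k, firstLevels P k = {a | f a ≤ k} := by
    intro k
    induction k with
    | zero =>
      ext a
      simpa [firstLevels] using Nat.one_le_iff_ne_zero.1 (hpos a)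
    | succ k ih =>
      ext a
      simp only [firstLevels, ih, Set.mem_union, Set.mem_ofPred_eq, not_le]
      constructor
      · rintro (h | h)
        · omega
        · by_contra hc
          have := hpos a
          have h1 := h.prop
          obtain ⟨b, hb, hfb⟩ := hpred a (by omega)
          exact h.not_lt (y := b) (by omega) hb
      · intro h
        rcases Nat.lt_or_ge k (f a) with h1 | h1
        · refine Or.inr ⟨h1, fun b hb hba => ?_⟩
          rcases hba.lt_or_eq with h2 | h2
          · have := hlt _ _ h2
            omega
          · exact h2.ge
        · exact Or.inl h1
  have h1 : level a = sInf {k | f a ≤ k} := by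
    simp only [level, key, Set.mem_ofPred_eq]
  rw [h1]
  exact csInf_Ici

theorem exists_isPart_mem (a : P) : ∃ Y : Part P, Y.IsPart ∧ a ∈ Y.verts := by
  by_cases h : a ∈ outsideTangles P
  · exact ⟨.cloneSet {x | x ∈ outsideTangles P ∧ Clones x a}, ⟨a, h, rfl⟩, h, rfl⟩
  · simp only [outsideTangles, Set.mem_ofPred_eq, not_forall, not_not] at h
    obtain ⟨A, B, hAB, ha⟩ := h
    exact ⟨.tangle A B, hAB, ha⟩

theorem HasLetter.level_mem {Y : Part P} {l : Letter} (h : HasLetter Y l) {a : P}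
    (ha : a ∈ Y.verts) : level a ∈ l.levels := by
  cases Y with
  | cloneSet C =>
    cases l with
    | c i => exact h a ha
    | t i => exact h.elim
  | tangle A B =>
    cases l with
    | c i => exact h.elim
    | t i => exact ha.elim (fun ha => Or.inr (h.2 a ha)) (fun ha => Or.inl (h.1 a ha))

theorem HasLetter.exists_level_eq {Y : Part P} {l : Letter} (h : HasLetter Y l) (hY : Y.IsPart)
    {k : ℕ} (hk : k ∈ l.levels) : ∃ a ∈ Y.verts, level a = k := by
  cases Y with
  | cloneSet C =>
    cases l with
    | c i =>
      obtain ⟨a, ha, rfl⟩ := hY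
      exact ⟨a, ⟨ha, rfl⟩, (h a ⟨ha, rfl⟩).trans hk.symm⟩
    | t i => exact h.elim
  | tangle A B =>
    cases l with
    | c i => exact h.elim
    | t i =>
      obtain ⟨a, ha⟩ := hY.1.1.nonempty
      obtain ⟨b, hb⟩ := hY.2.1.1.nonempty
      rcases hk with rfl | rfl
      · exact ⟨b, Or.inr hb, h.1 b hb⟩
      · exact ⟨a, Or.inl ha, h.2 a ha⟩

theorem Letter.idx_mem_levels (l : Letter) : l.idx ∈ l.levels := by
  cases l with
  | c i => rfl
  | t i => exact Or.inl rfl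

theorem Letter.idx_le_of_mem_levels {l : Letter} {k : ℕ} (h : k ∈ l.levels) : l.idx ≤ k := by
  cases l with
  | c i => exact h.ge
  | t i => rcases h with rfl | rfl <;> simp [Letter.idx]

/-- Genuine parts are nonempty, so the lowest occupied level fixes the index; the kind of part fixes
the kind of letter. -/
theorem HasLetter.unique {Y : Part P} (hY : Y.IsPart) {l l' : Letter} (h : HasLetter Y l)
    (h' : HasLetter Y l') : l = l' := by
  have h1 : l.idx = l'.idx := by
    obtain ⟨a, ha, e⟩ := h.exists_level_eq hY l.idx_mem_levels
    obtain ⟨a', ha', e'⟩ := h'.exists_level_eq hY l'.idx_mem_levels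
    have h2 := Letter.idx_le_of_mem_levels (h'.level_mem ha)
    have h3 := Letter.idx_le_of_mem_levels (h.level_mem ha')
    omega
  cases Y <;> cases l <;> cases l' <;> first | exact h.elim | exact h'.elim | skip
  all_goals simpa [Letter.idx] using h1

/-! ### Compatible listings -/

/-- The condition on parts `Y`, `Z` appearing in this order in a compatible listing. -/
def Prec (Y Z : Part P) : Prop :=
  ∀ a ∈ Y.verts, ∀ b ∈ Z.verts,
    (a < b ↔ level a + 1 ≤ level b) ∧ (b < a ↔ level b + 2 ≤ level a)

theorem isCompatibleListing_iff {X : List (Part P)} :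
    IsCompatibleListing X ↔ X.Nodup ∧ (∀ Y : Part P, Y ∈ X ↔ Y.IsPart) ∧ X.Pairwise Prec := by
  refine and_congr Iff.rfl (and_congr Iff.rfl ?_)
  rw [List.pairwise_iff_get]
  constructor
  · intro h i j hij a ha b hb
    have h1 := h i j hij.ne a ha b hb
    have h2 := h j i hij.ne' b hb a ha
    have h3 : ¬ j < i := hij.not_gt
    simp only [hij, h3, and_true, and_false, or_false] at h1 h2
    refine ⟨h1.trans ?_, h2⟩
    omega
  · intro h i j hij a ha b hb
    rcases lt_or_gt_of_ne hij with h1 | h1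
    · have h2 := (h i j h1 a ha b hb).1
      simp only [h1, and_true]
      refine h2.trans ?_
      omega
    · have h2 := (h j i h1 b hb a ha).2
      simpa only [h1.not_gt, and_false, or_false] using h2

/-- Between far levels a gap of at least one is the same as a gap of at least two, so the condition
is symmetric. -/
theorem Prec.swap {Y Z : Part P} {l l' : Letter} (hY : HasLetter Y l) (hZ : HasLetter Z l')
    (hf : l.Far l') (h : Prec Y Z) : Prec Z Y := by
  intro a ha b hb
  have h1 := h b hb a ha
  have h2 := hf _ (hY.level_mem hb) _ (hZ.level_mem ha)
  refine ⟨h1.2.trans ?_, h1.1.trans ?_⟩ <;> omega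

theorem Prec.swap_cloneSet {C C' : Set P} {i : ℕ+} (hC : HasLetter (.cloneSet C) (.c i))
    (hC' : HasLetter (.cloneSet C') (.c i)) (h : Prec (.cloneSet C) (.cloneSet C')) :
    Prec (.cloneSet C') (.cloneSet C) := by
  intro a ha b hb
  have h1 := h b hb a ha
  have h2 := hC b hb
  have h3 := hC' a ha
  refine ⟨h1.2.trans ?_, h1.1.trans ?_⟩ <;> omega

theorem IsCompatibleListing.swap {X₁ X₂ : List (Part P)} {Y Z : Part P}
    (h : IsCompatibleListing (X₁ ++ Y :: Z :: X₂)) (hs : Prec Y Z → Prec Z Y) :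
    IsCompatibleListing (X₁ ++ Z :: Y :: X₂) := by
  rw [isCompatibleListing_iff] at h ⊢
  have hp : (X₁ ++ Z :: Y :: X₂).Perm (X₁ ++ Y :: Z :: X₂) :=
    List.Perm.append_left _ (List.Perm.swap _ _ _)
  refine ⟨hp.nodup_iff.2 h.1, fun W => hp.mem_iff.trans (h.2.1 W), ?_⟩
  have h3 := h.2.2
  simp only [List.pairwise_append, List.pairwise_cons, List.mem_cons] at h3 ⊢
  obtain ⟨p1, ⟨p2, p3, p4⟩, p5⟩ := h3
  refine ⟨p1, ⟨?_, fun W hW => p2 W (Or.inr hW), p4⟩, fun V hV W hW => p5 V hV W (by tauto)⟩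
  rintro W (rfl | hW)
  · exact hs (p2 _ (Or.inl rfl))
  · exact p3 W hW

theorem IsCloneSet.not_lt {C : Set P} (h : IsCloneSet C) {a b : P} (ha : a ∈ C) (hb : b ∈ C) :
    ¬ a < b := by
  obtain ⟨c, -, rfl⟩ := h
  intro hab
  have h1 : Set.Iio a = Set.Iio b := congrArg Prod.fst (ha.2.trans hb.2.symm)
  exact lt_irrefl a (h1.symm ▸ hab : a ∈ Set.Iio a)

theorem IsCloneSet.eq_of_clones {C C' : Set P} (h : IsCloneSet C) (h' : IsCloneSet C') {a b : P}
    (ha : a ∈ C) (hb : b ∈ C') (hab : Clones a b) : C = C' := by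
  obtain ⟨c, -, rfl⟩ := h
  obtain ⟨c', -, rfl⟩ := h'
  have : view c = view c' := (ha.2 : view a = view c).symm.trans (Eq.trans hab hb.2)
  simp only [Clones, this]

/-- On a fixed level, a later position only enlarges the downset and shrinks the upset. `Prec` alone
says nothing about the order of two clone sets on one level; this nesting supplies the missing
information. -/
theorem IsCompatibleListing.subset_of_lt {X : List (Part P)} (hX : IsCompatibleListing X)
    {C C' : Set P} {k : ℕ} (hC : ∀ a ∈ C, level a = k) (hC' : ∀ a ∈ C', level a = k)
    {i j : Fin X.length} (hij : i < j) (hi : X.get i = .cloneSet C) (hj : X.get j = .cloneSet C')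
    {a b : P} (ha : a ∈ C) (hb : b ∈ C') :
    Set.Iio a ⊆ Set.Iio b ∧ Set.Ioi b ⊆ Set.Ioi a := by
  obtain ⟨-, hmem, hc⟩ := hX
  have pC : IsCloneSet C := (hmem (.cloneSet C)).1 (hi ▸ X.get_mem i)
  have pC' : IsCloneSet C' := (hmem (.cloneSet C')).1 (hj ▸ X.get_mem j)
  have ha' : a ∈ (X.get i).verts := hi ▸ ha
  have hb' : b ∈ (X.get j).verts := hj ▸ hb
  have la := hC a ha
  have lb := hC' b hb
  have hpos : ∀ z : P, ∃ r : Fin X.length, z ∈ (X.get r).verts := by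
    intro z
    obtain ⟨Y, hY, hz⟩ := exists_isPart_mem z
    obtain ⟨r, hr⟩ := List.mem_iff_get.1 ((hmem Y).2 hY)
    exact ⟨r, hr ▸ hz⟩
  constructor
  · intro z hz
    rw [Set.mem_Iio] at hz ⊢
    obtain ⟨r, hr⟩ := hpos z
    by_cases h1 : r = i
    · subst h1
      rw [hi] at hr
      exact absurd hz (pC.not_lt hr ha)
    by_cases h2 : r = j
    · subst h2
      have h3 := (hc r i h1 z hr a ha').1 hz
      rw [hj] at hr
      have := hC' z hr
      omega
    · have h3 := (hc r i h1 z hr a ha').1 hz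
      refine (hc r j h2 z hr b hb').2 ?_
      rw [lb, ← la]
      exact h3.imp id fun h => ⟨h.1, h.2.trans hij⟩
  · intro z hz
    rw [Set.mem_Ioi] at hz ⊢
    obtain ⟨r, hr⟩ := hpos z
    by_cases h1 : r = j
    · subst h1
      rw [hj] at hr
      exact absurd hz (pC'.not_lt hb hr)
    by_cases h2 : r = i
    · subst h2
      have h3 := (hc j r (Ne.symm h1) b hb' z hr).1 hz
      rw [hi] at hr
      have := hC z hr
      omega
    · have h3 := (hc j r (Ne.symm h1) b hb' z hr).1 hz
      refine (hc i r (Ne.symm h2) a ha' z hr).2 ?_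
      rw [la, ← lb]
      exact h3.imp id fun h => ⟨h.1, hij.trans h.2⟩

/-- The condition that a part `Y` be before `Z` for vertices on the same level in clone sets. -/
def PrecClone (Y Z : Part P) : Prop :=
  ∀ C C' : Set P, Y = .cloneSet C → Z = .cloneSet C' → ∀ k : ℕ, (∀ a ∈ C, level a = k) →
    (∀ a ∈ C', level a = k) → ∀ a ∈ C, ∀ b ∈ C', Set.Iio a ⊆ Set.Iio b ∧ Set.Ioi b ⊆ Set.Ioi a

theorem IsCompatibleListing.pairwise_precClone {X : List (Part P)} (hX : IsCompatibleListing X) :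
    X.Pairwise PrecClone := by
  rw [List.pairwise_iff_get]
  intro i j hij C C' hi hj k hC hC' a ha b hb
  exact hX.subset_of_lt hC hC' hij hi hj ha hb

theorem eq_of_precClone {C C' : Set P} {i : ℕ+} (hC : HasLetter (.cloneSet C) (.c i))
    (hC' : HasLetter (.cloneSet C') (.c i)) (pC : IsCloneSet C) (pC' : IsCloneSet C')
    (h : PrecClone (.cloneSet C) (.cloneSet C')) (h' : PrecClone (.cloneSet C') (.cloneSet C)) :
    C = C' := by
  obtain ⟨a, ha, -⟩ := hC.exists_level_eq (Y := .cloneSet C) pC (k := i) rfl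
  obtain ⟨b, hb, -⟩ := hC'.exists_level_eq (Y := .cloneSet C') pC' (k := i) rfl
  have h1 := h C C' rfl rfl i hC hC' a ha b hb
  have h2 := h' C' C rfl rfl i hC' hC b hb a ha
  refine pC.eq_of_clones pC' ha hb ?_
  rw [Clones, view, view, h1.1.antisymm h2.1, h2.2.antisymm h1.2]

/-- Two distinct parts that may come in either order have far apart letters. -/
theorem far_of_prec {Y Z : Part P} {l l' : Letter} (hY : Y.IsPart) (hZ : Z.IsPart)
    (hl : HasLetter Y l) (hl' : HasLetter Z l') (hne : Y ≠ Z) (h1 : Prec Y Z) (h2 : Prec Z Y)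
    (h3 : PrecClone Y Z) (h4 : PrecClone Z Y) : l.Far l' := by
  -- At level distance one the two orders demand opposite answers to whether the vertices are
  -- comparable.
  have key : ∀ k ∈ l.levels, ∀ k' ∈ l'.levels, k + 1 ≠ k' ∧ k' + 1 ≠ k := by
    intro k hk k' hk'
    obtain ⟨a, ha, rfl⟩ := hl.exists_level_eq hY hk
    obtain ⟨b, hb, rfl⟩ := hl'.exists_level_eq hZ hk'
    have e1 := h1 a ha b hb
    have e2 := h2 b hb a ha
    have e3 := e1.1.symm.trans e2.2
    have e4 := e1.2.symm.trans e2.1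
    omega
  intro k hk k' hk'
  have hkk := key k hk k' hk'
  -- A shared level is impossible: a tangle would also occupy an adjacent level, against `key`, and
  -- two clone sets would be equal.
  by_cases hk2 : k = k'
  · subst hk2
    exfalso
    cases l with
    | c i =>
      cases l' with
      | c j =>
        have hij : i = j := PNat.coe_injective ((hk : k = i).symm.trans hk')
        subst hij
        cases Y with
        | tangle A B => exact hl.elim
        | cloneSet C =>
          cases Z with
          | tangle A B => exact hl'.elim
          | cloneSet C' => exact hne (by rw [eq_of_precClone hl hl' hY hZ h3 h4])
      | t j =>
        have e1 := key i rfl j (Or.inl rfl)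
        have e2 := key i rfl (j + 1) (Or.inr rfl)
        have e3 : k = i := hk
        have e4 : k = j ∨ k = j + 1 := hk'
        omega
    | t i =>
      have e1 := key i (Or.inl rfl) k hk'
      have e2 := key (i + 1) (Or.inr rfl) k hk'
      have e3 : k = i ∨ k = i + 1 := hk
      omega
  · omega

/-- Everything before the head `Y` of `X` in `Z` comes after `Y` in `X`. Such parts occur in both
orders, hence are far from `Y`, and the letter of `Y` can be moved to the front of the word of `Z`.
-/
theorem trace_map_eq_of_pairwise (f : Part P → Letter) {X Z : List (Part P)} (hperm : X.Perm Z)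
    (hn : X.Nodup) (hp : ∀ Y ∈ X, Y.IsPart ∧ HasLetter Y (f Y))
    (hX : X.Pairwise fun V W => Prec V W ∧ PrecClone V W)
    (hZ : Z.Pairwise fun V W => Prec V W ∧ PrecClone V W) : trace (X.map f) = trace (Z.map f) := by
  induction X generalizing Z with
  | nil => rw [hperm.nil_eq]
  | cons Y X ih =>
    obtain ⟨Z₁, Z₂, rfl⟩ := List.append_of_mem (hperm.subset (List.mem_cons_self))
    have hperm' : X.Perm (Z₁ ++ Z₂) :=
      List.Perm.cons_inv (hperm.trans List.perm_middle)
    rw [List.pairwise_cons] at hX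
    have hZ' := hZ.sublist (List.Sublist.append_left (List.sublist_cons_self Y Z₂) Z₁)
    have e := ih hperm' (List.nodup_cons.1 hn).2 (fun W hW => hp W (by simp [hW])) hX.2 hZ'
    rw [List.map_cons, trace_cons_congr _ e, List.map_append, List.map_append, List.map_cons]
    refine (trace_move_front ?_ _).symm
    intro l hl
    obtain ⟨W, hW, rfl⟩ := List.mem_map.1 hl
    have hWX : W ∈ X := hperm'.symm.subset (by simp [hW])
    have q1 := hX.1 W hWX
    have q2 := (List.pairwise_append.1 hZ).2.2 W hW Y (by simp)
    have hYp := hp Y (by simp)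
    have hWp := hp W (by simp [hWX])
    refine far_of_prec hYp.1 hWp.1 hYp.2 hWp.2 ?_ q1.1 q2.1 q1.2 q2.2
    rintro rfl
    exact (List.nodup_cons.1 hn).1 hWX

open Classical in
/-- The letter of a part, if it has one. -/
noncomputable def letterOf (Y : Part P) : Letter :=
  if h : ∃ l, HasLetter Y l then h.choose else .c 1

theorem letterOf_eq {Y : Part P} (hY : Y.IsPart) {l : Letter} (h : HasLetter Y l) :
    letterOf Y = l := by
  have h' : ∃ l, HasLetter Y l := ⟨l, h⟩
  rw [letterOf, dif_pos h']
  exact h'.choose_spec.unique hY h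

theorem map_letterOf_eq {X : List (Part P)} {w : List Letter} (hX : ∀ Y ∈ X, Y.IsPart)
    (h : List.Forall₂ HasLetter X w) : X.map letterOf = w := by
  induction h with
  | nil => rfl
  | cons h _ ih =>
    rw [List.map_cons, letterOf_eq (hX _ (by simp)) h, ih fun Y hY => hX Y (by simp [hY])]

theorem hasLetter_letterOf {X : List (Part P)} {w : List Letter} (hX : ∀ Y ∈ X, Y.IsPart)
    (h : List.Forall₂ HasLetter X w) : ∀ Y ∈ X, HasLetter Y (letterOf Y) := by
  induction h with
  | nil => simp
  | cons h _ ih =>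
    intro Y hY
    rcases List.mem_cons.1 hY with rfl | hY
    · rwa [letterOf_eq (hX _ (by simp)) h]
    · exact ih (fun Y hY => hX Y (by simp [hY])) Y hY

/-- All words of compatible listings represent the same element of `M`. -/
theorem trace_eq_of_isListingWord {w w' : FreeMonoid Letter} (h : IsListingWord P w)
    (h' : IsListingWord P w') : trace w.toList = trace w'.toList := by
  obtain ⟨X, hX, hw⟩ := h
  obtain ⟨X', hX', hw'⟩ := h'
  have c := hX.pairwise_precClone
  have c' := hX'.pairwise_precClone
  rw [isCompatibleListing_iff] at hX hX'
  have p : ∀ Y ∈ X, Y.IsPart := fun Y => (hX.2.1 Y).1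
  have p' : ∀ Y ∈ X', Y.IsPart := fun Y => (hX'.2.1 Y).1
  rw [← map_letterOf_eq p hw, ← map_letterOf_eq p' hw']
  refine trace_map_eq_of_pairwise letterOf ?_ hX.1
    (fun Y hY => ⟨p Y hY, hasLetter_letterOf p hw Y hY⟩) (hX.2.2.and c) (hX'.2.2.and c')
  exact (List.perm_ext_iff_of_nodup hX.1 hX'.1).2 fun Y => (hX.2.1 Y).trans (hX'.2.1 Y).symm

theorem exists_of_forall₂_append_pair {α β : Type*} {R : α → β → Prop} {X : List α}
    {u v : List β} {x y : β} (h : List.Forall₂ R X (u ++ x :: y :: v)) :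
    ∃ X₁ Y Z X₂, X = X₁ ++ Y :: Z :: X₂ ∧ List.Forall₂ R X₁ u ∧ R Y x ∧ R Z y ∧
      List.Forall₂ R X₂ v := by
  induction u generalizing X with
  | nil =>
    rcases h with _ | ⟨h1, _ | ⟨h2, h3⟩⟩
    exact ⟨[], _, _, _, rfl, .nil, h1, h2, h3⟩
  | cons a u ih =>
    rcases h with _ | ⟨h1, h2⟩
    obtain ⟨X₁, Y, Z, X₂, rfl, q1, q2, q3, q4⟩ := ih h2
    exact ⟨_ :: X₁, Y, Z, X₂, rfl, .cons h1 q1, q2, q3, q4⟩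

/-! ### Listing words are closed under commutation. -/

theorem IsListingWord.swap {u v : List Letter} {x y : Letter} (hf : x.Far y)
    (h : IsListingWord P (FreeMonoid.ofList (u ++ x :: y :: v))) :
    IsListingWord P (FreeMonoid.ofList (u ++ y :: x :: v)) := by
  obtain ⟨X, hX, hw⟩ := h
  obtain ⟨X₁, Y, Z, X₂, rfl, q1, q2, q3, q4⟩ := exists_of_forall₂_append_pair hw
  exact ⟨X₁ ++ Z :: Y :: X₂, hX.swap (Prec.swap q2 q3 hf),
    List.rel_append q1 (.cons q3 (.cons q2 q4))⟩

variable (P) in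
/-- The congruence of words that are interchangeable as factors of words of listings. -/
def listingCon : Con (FreeMonoid Letter) where
  r a b := ∀ u v, IsListingWord P (u * a * v) ↔ IsListingWord P (u * b * v)
  iseqv := ⟨fun _ _ _ => Iff.rfl, fun h u v => (h u v).symm,
    fun h h' u v => (h u v).trans (h' u v)⟩
  mul' {a b c d} h h' u v := by
    have h1 := h u (c * v)
    have h2 := h' (u * b) v
    simp only [mul_assoc] at h1 h2 ⊢
    exact h1.trans h2

theorem IsListingWord.of_mk_eq {w w' : FreeMonoid Letter} (h : IsListingWord P w)
    (e : PresentedMonoid.mk CommRel w = PresentedMonoid.mk CommRel w') : IsListingWord P w' := by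
  have hle : conGen CommRel ≤ listingCon P := by
    refine Con.conGen_le.2 fun a b hab => ?_
    obtain ⟨x, y, hf, rfl, rfl⟩ := exists_far_of_commRel hab
    intro u v
    have e1 : ∀ x y : Letter, u * FreeMonoid.ofList [x, y] * v =
        FreeMonoid.ofList (u.toList ++ x :: y :: v.toList) := by
      intro x y
      apply FreeMonoid.toList.injective
      simp
    rw [e1, e1]
    exact ⟨fun h => h.swap hf, fun h => h.swap hf.symm⟩
  have h1 : conGen CommRel w w' := Quotient.exact e
  simpa using (hle h1 1 1).1 (by simpa using h)

/-! ### Necessity of conditions (i) and (ii). -/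

theorem IsListingWord.head {l : Letter} {v : List Letter}
    (h : IsListingWord P (FreeMonoid.ofList (l :: v))) : l.idx = 1 := by
  obtain ⟨X, hX, hw⟩ := h
  rw [isCompatibleListing_iff] at hX
  rcases hw with _ | ⟨h1, -⟩
  rename_i Y X
  have pY := (hX.2.1 Y).1 (by simp)
  obtain ⟨a, ha, hla⟩ := h1.exists_level_eq pY l.idx_mem_levels
  by_contra hne
  have := l.idx_pos
  obtain ⟨x, hx, hlx⟩ := exists_lt_level_eq (a := a) (by omega)
  obtain ⟨Z, hZ, hxZ⟩ := exists_isPart_mem x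
  rcases List.mem_cons.1 ((hX.2.1 Z).2 hZ) with rfl | hZX
  · have := Letter.idx_le_of_mem_levels (h1.level_mem hxZ)
    omega
  · have h2 := ((List.pairwise_cons.1 hX.2.2).1 Z hZX a ha x hxZ).2.1 hx
    omega

theorem IsListingWord.not_cc {u v : List Letter} {i : ℕ+} :
    ¬ IsListingWord P (FreeMonoid.ofList (u ++ .c i :: .c i :: v)) := by
  rintro ⟨X, hX, hw⟩
  obtain ⟨X₁, Y, Z, X₂, rfl, -, q2, q3, -⟩ := exists_of_forall₂_append_pair hw
  cases Y with
  | tangle A B => exact q2.elim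
  | cloneSet C =>
    cases Z with
    | tangle A B => exact q3.elim
    | cloneSet C' =>
      -- With both orders compatible, upsets and downsets are nested both ways, so the two sets
      -- coincide and the listing repeats a part.
      have hX' := hX.swap (Prec.swap_cloneSet q2 q3)
      have c := hX.pairwise_precClone
      have c' := hX'.pairwise_precClone
      simp only [List.pairwise_append, List.pairwise_cons] at c c'
      have e := eq_of_precClone q2 q3 ((hX.2.1 (.cloneSet C)).1 (by simp))
        ((hX.2.1 (.cloneSet C')).1 (by simp))
        (c.2.1.1 _ (by simp)) (c'.2.1.1 _ (by simp))
      subst e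
      have := hX.1
      simp [List.nodup_append] at this

end Poset

/-! ### The poset of a word -/

/-- The letters of clone sets. -/
def Letter.IsC : Letter → Prop
  | .c _ => True
  | .t _ => False

/-- The vertices of the poset of a word: one vertex for each letter `c i`, and two top and two
bottom vertices for each letter `t i`. -/
structure Vertex (L : List Letter) : Type u where
  /-- the position in the word -/
  pos : Fin L.length
  /-- whether this is a top vertex of a tangle -/
  top : Bool
  /-- the side of the tangle -/
  side : Bool
  ok : (L.get pos).IsC → top = false ∧ side = false

namespace Vertex

variable {L : List Letter}

/-- The level of a vertex. -/
def lv (x : Vertex.{u} L) : ℕ := (L.get x.pos).idx + x.top.toNat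

theorem lv_pos (x : Vertex.{u} L) : 1 ≤ x.lv := Nat.le_add_right_of_le (Letter.idx_pos _)

theorem lv_le_of_pos_eq {x y : Vertex.{u} L} (h : x.pos = y.pos) : x.lv ≤ y.lv + 1 := by
  have := Bool.toNat_le x.top
  rw [lv, lv, h]
  omega

theorem exists_pos_lv (p : Fin L.length) {k : ℕ} (hk : k ∈ (L.get p).levels) :
    ∃ x : Vertex.{u} L, x.pos = p ∧ x.lv = k := by
  by_cases hc : (L.get p).IsC
  · refine ⟨⟨p, false, false, fun _ => ⟨rfl, rfl⟩⟩, rfl, ?_⟩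
    rw [lv]
    dsimp only
    generalize L.get p = l at hk hc
    cases l with
    | c i => exact hk.symm
    | t i => exact hc.elim
  · have h1 : ∀ b, (⟨p, b, false, fun h => (hc h).elim⟩ : Vertex.{u} L).lv =
      (L.get p).idx + b.toNat := fun _ => rfl
    have h2 : k = (L.get p).idx ∨ k = (L.get p).idx + 1 := by
      clear h1
      generalize L.get p = l at hk hc
      cases l with
      | c i => exact (hc trivial).elim
      | t i => exact hk
    rcases h2 with rfl | rfl
    · exact ⟨_, rfl, h1 false⟩
    · exact ⟨_, rfl, h1 true⟩

theorem ext' {x y : Vertex.{u} L} (h1 : x.pos = y.pos) (h2 : x.top = y.top)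
    (h3 : x.side = y.side) : x = y := by
  cases x; cases y; cases h1; cases h2; cases h3; rfl

instance : Finite (Vertex.{u} L) :=
  Finite.of_injective (fun x => (x.pos, x.top, x.side)) fun _ _ h =>
    ext' (congrArg Prod.fst h) (congrArg (fun z => z.2.1) h) (congrArg (fun z => z.2.2) h)

/-- The strict order. -/
def Below (x y : Vertex.{u} L) : Prop :=
  x.lv + 2 ≤ y.lv ∨ x.lv + 1 = y.lv ∧ (x.pos < y.pos ∨ x.pos = y.pos ∧ x.side = y.side)

theorem Below.lv_lt {x y : Vertex.{u} L} (h : Below x y) : x.lv < y.lv := by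
  rcases h with h | h <;> omega

instance : PartialOrder (Vertex.{u} L) where
  le x y := x = y ∨ Below x y
  lt := Below
  le_refl x := Or.inl rfl
  le_trans x y z := by
    rintro (rfl | h) (rfl | h')
    · exact Or.inl rfl
    · exact Or.inr h'
    · exact Or.inr h
    -- Two strict steps raise the level by at least two, where comparability is automatic.
    · have := h.lv_lt
      have := h'.lv_lt
      exact Or.inr (Or.inl (by omega))
  le_antisymm x y := by
    rintro (rfl | h) (h' | h')
    · rfl
    · rfl
    · exact h'.symm
    · have := h.lv_lt
      have := h'.lv_lt
      omega
  lt_iff_le_not_ge x y := by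
    constructor
    · intro h
      refine ⟨Or.inr h, ?_⟩
      rintro (rfl | h')
      · exact lt_irrefl _ h.lv_lt
      · exact lt_asymm h.lv_lt h'.lv_lt
    · rintro ⟨rfl | h, h'⟩
      · exact (h' (Or.inl rfl)).elim
      · exact h

theorem lt_def {x y : Vertex.{u} L} : x < y ↔ x.lv + 2 ≤ y.lv ∨
    x.lv + 1 = y.lv ∧ (x.pos < y.pos ∨ x.pos = y.pos ∧ x.side = y.side) := Iff.rfl

theorem lv_lt_of_lt {x y : Vertex.{u} L} (h : x < y) : x.lv < y.lv := Below.lv_lt h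

theorem lt_iff_of_pos_ne {x y : Vertex.{u} L} (h : x.pos ≠ y.pos) :
    x < y ↔ x.lv + 2 ≤ y.lv ∨ x.lv + 1 = y.lv ∧ x.pos < y.pos := by
  simp [lt_def, h]

theorem pos_le_of_lt {x y : Vertex.{u} L} (h : x < y) (h' : y.lv ≤ x.lv + 1) : x.pos ≤ y.pos := by
  rcases h with h | ⟨-, h | h⟩
  · omega
  · exact h.le
  · exact h.1.le

theorem pos_le_of_not_lt {x y : Vertex.{u} L} (h : ¬ x < y) (h' : x.lv + 1 = y.lv) :
    y.pos ≤ x.pos := by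
  by_contra hc
  exact h (Or.inr ⟨h', Or.inl (not_le.1 hc)⟩)

/-- Incomparability of `d` with `a` and `c` forces three consecutive levels with `d` in the middle.
The positions then satisfy `c ≤ d ≤ a ≤ b ≤ c`, so `a` and `c` share a position, but a position
spans only two levels. -/
theorem threeOneFree : ThreeOneFree (Vertex.{u} L) := by
  rintro ⟨a, b, c, d, hab, hbc, ha, hb, hc⟩
  have h1 := lv_lt_of_lt hab
  have h2 := lv_lt_of_lt hbc
  have h3 : ¬ a < d := fun h => ha.2 h.le
  have h4 : ¬ d < c := fun h => hc.1 h.le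
  have h5 : ¬ a.lv + 2 ≤ d.lv := fun h => h3 (Or.inl h)
  have h6 : ¬ d.lv + 2 ≤ c.lv := fun h => h4 (Or.inl h)
  have h7 := pos_le_of_not_lt h3 (by omega)
  have h8 := pos_le_of_not_lt h4 (by omega)
  have h9 := pos_le_of_lt hab (by omega)
  have h10 := pos_le_of_lt hbc (by omega)
  have h11 := lv_le_of_pos_eq (show c.pos = a.pos by omega)
  omega

/-! ### Tangles of the poset of a word -/

/-- The top vertices at a position. -/
def tops (p : Fin L.length) : Set (Vertex.{u} L) := {x | x.pos = p ∧ x.top = true}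

/-- The bottom vertices at a position. -/
def bots (p : Fin L.length) : Set (Vertex.{u} L) := {x | x.pos = p ∧ x.top = false}

/-- Downsets grow lexicographically in level and position. The only pairs for which this gives no
inclusion either way are the two tops of one tangle. -/
theorem Iio_subset {a b : Vertex.{u} L} (h : a.lv < b.lv ∨ a.lv = b.lv ∧ (a.pos < b.pos ∨
    a.pos = b.pos ∧ (a.side = b.side ∨ a.top = false))) : Set.Iio a ⊆ Set.Iio b := by
  intro z hz
  rw [Set.mem_Iio, lt_def] at *
  rcases h with h | ⟨h, h' | ⟨h', h'' | h''⟩⟩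
  · rcases hz with hz | hz
    · exact Or.inl (by omega)
    · exact Or.inl (by omega)
  · rcases hz with hz | ⟨hz, hz'⟩
    · exact Or.inl (by omega)
    · refine Or.inr ⟨by omega, Or.inl ?_⟩
      rcases hz' with hz' | hz'
      · exact hz'.trans h'
      · exact hz'.1 ▸ h'
  · rwa [← h, ← h', ← h'']
  · rcases hz with hz | ⟨hz, hz' | hz'⟩
    · exact Or.inl (by omega)
    · exact Or.inr ⟨by omega, Or.inl (h' ▸ hz')⟩
    · simp only [lv, hz'.1, h'', Bool.toNat_false] at hz
      omega

theorem Ioi_subset {a b : Vertex.{u} L} (h : b.lv < a.lv ∨ a.lv = b.lv ∧ (b.pos < a.pos ∨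
    a.pos = b.pos ∧ (a.side = b.side ∨ a.top = true))) : Set.Ioi a ⊆ Set.Ioi b := by
  intro z hz
  rw [Set.mem_Ioi, lt_def] at *
  rcases h with h | ⟨h, h' | ⟨h', h'' | h''⟩⟩
  · rcases hz with hz | hz
    · exact Or.inl (by omega)
    · exact Or.inl (by omega)
  · rcases hz with hz | ⟨hz, hz'⟩
    · exact Or.inl (by omega)
    · refine Or.inr ⟨by omega, Or.inl ?_⟩
      rcases hz' with hz' | hz'
      · exact h'.trans hz'
      · exact hz'.1 ▸ h'
  · rwa [← h, ← h', ← h'']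
  · rcases hz with hz | ⟨hz, hz' | hz'⟩
    · exact Or.inl (by omega)
    · exact Or.inr ⟨by omega, Or.inl (h' ▸ hz')⟩
    · have := Bool.toNat_le z.top
      simp only [lv, hz'.1, h'', Bool.toNat_true] at hz
      omega

theorem not_isC_of_side_ne {a b : Vertex.{u} L} (h : a.pos = b.pos) (hs : a.side ≠ b.side) :
    ¬ (L.get a.pos).IsC := fun hc =>
  hs ((a.ok hc).2.trans (b.ok (h ▸ hc)).2.symm)

theorem not_isC_of_top {a : Vertex.{u} L} (h : a.top = true) : ¬ (L.get a.pos).IsC := fun hc =>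
  Bool.false_ne_true ((a.ok hc).1.symm.trans h)

theorem topGraph_adj {a b : Vertex.{u} L} : (topGraph (Vertex.{u} L)).Adj a b ↔
    a.pos = b.pos ∧ a.top = true ∧ b.top = true ∧ a.side ≠ b.side := by
  constructor
  · rintro ⟨h, h'⟩
    have h1 := mt Iio_subset h
    have h2 := mt Iio_subset h'
    have hl : a.lv = b.lv := by omega
    have hp : a.pos = b.pos := by
      simp only [hl, true_and, not_or] at h1 h2
      exact le_antisymm (not_lt.1 h2.2.1) (not_lt.1 h1.2.1)
    simp only [hl, hp, true_and, lt_irrefl, false_or, not_or] at h1 h2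
    exact ⟨hp, by simpa using h1.2, by simpa using h2.2, h1.1⟩
  · have key : ∀ a b : Vertex.{u} L, a.pos = b.pos → a.top = true → b.top = true →
        a.side ≠ b.side → ¬ Set.Iio a ⊆ Set.Iio b := by
      intro a b hp ha hb hs h
      -- The bottom on the side of `a` lies below `a` but not below the other top.
      let z : Vertex.{u} L := ⟨a.pos, false, a.side, fun hc => (not_isC_of_top ha hc).elim⟩
      have hz : z < a := Or.inr ⟨by simp [lv, z, ha], Or.inr ⟨rfl, rfl⟩⟩
      have hz' : z < b := h hz
      rcases hz' with h1 | ⟨-, h1 | h1⟩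
      · have := lv_le_of_pos_eq (x := b) (y := z) hp.symm
        omega
      · exact h1.ne hp
      · exact hs h1.2
    rintro ⟨hp, ha, hb, hs⟩
    exact ⟨key a b hp ha hb hs, key b a hp.symm hb ha hs.symm⟩

theorem botGraph_adj {a b : Vertex.{u} L} : (botGraph (Vertex.{u} L)).Adj a b ↔
    a.pos = b.pos ∧ a.top = false ∧ b.top = false ∧ a.side ≠ b.side := by
  constructor
  · rintro ⟨h, h'⟩
    have h1 := mt Ioi_subset h
    have h2 := mt Ioi_subset h'
    have hl : a.lv = b.lv := by omega
    have hp : a.pos = b.pos := by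
      simp only [hl, true_and, not_or] at h1 h2
      exact le_antisymm (not_lt.1 h1.2.1) (not_lt.1 h2.2.1)
    simp only [hl, hp, true_and, lt_irrefl, false_or, not_or] at h1 h2
    exact ⟨hp, by simpa using h1.2, by simpa using h2.2, h1.1⟩
  · have key : ∀ a b : Vertex.{u} L, a.pos = b.pos → a.top = false → b.top = false →
        a.side ≠ b.side → ¬ Set.Ioi a ⊆ Set.Ioi b := by
      intro a b hp ha hb hs h
      let z : Vertex.{u} L :=
        ⟨a.pos, true, a.side, fun hc => (not_isC_of_side_ne hp hs hc).elim⟩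
      have hz : a < z := Or.inr ⟨by simp [lv, z, ha], Or.inr ⟨rfl, rfl⟩⟩
      have hz' : b < z := h hz
      rcases hz' with h1 | ⟨-, h1 | h1⟩
      · have := lv_le_of_pos_eq (x := z) (y := b) hp
        omega
      · exact h1.ne hp.symm
      · exact hs h1.2.symm
    rintro ⟨hp, ha, hb, hs⟩
    exact ⟨key a b hp ha hb hs, key b a hp.symm hb ha hs.symm⟩

/-- With only two sides, equality or adjacency is already transitive, so nontrivial components are
single edges. The flag `s` treats tops and bottoms together. -/
theorem exists_supp_eq_iff {G : SimpleGraph (Vertex.{u} L)} {s : Bool}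
    (hG : ∀ a b, G.Adj a b ↔ a.pos = b.pos ∧ a.top = s ∧ b.top = s ∧ a.side ≠ b.side)
    {A : Set (Vertex.{u} L)} : (A.Nontrivial ∧ ∃ K : G.ConnectedComponent, K.supp = A) ↔
      ∃ p, ¬ (L.get p).IsC ∧ A = {x | x.pos = p ∧ x.top = s} := by
  have hreach : ∀ a b, G.Reachable a b ↔ a = b ∨ G.Adj a b := by
    intro a b
    constructor
    · rintro ⟨w⟩
      induction w with
      | nil => exact Or.inl rfl
      | @cons x y z h _ ih =>
        rcases ih with rfl | ih
        · exact Or.inr h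
        · rw [hG] at h ih
          by_cases hs : x.side = z.side
          · exact Or.inl (ext' (h.1.trans ih.1) (h.2.1.trans ih.2.2.1.symm) hs)
          · exact Or.inr ((hG _ _).2 ⟨h.1.trans ih.1, h.2.1, ih.2.2.1, hs⟩)
    · rintro (rfl | h)
      · rfl
      · exact h.reachable
  have hclass : ∀ b : Vertex.{u} L, b.top = s → ∀ x, (x = b ∨ G.Adj x b) ↔
      x.pos = b.pos ∧ x.top = s := by
    intro b hb x
    rw [hG]
    constructor
    · rintro (rfl | h)
      · exact ⟨rfl, hb⟩
      · exact ⟨h.1, h.2.1⟩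
    · rintro ⟨h1, h2⟩
      by_cases h3 : x.side = b.side
      · exact Or.inl (ext' h1 (h2.trans hb.symm) h3)
      · exact Or.inr ⟨h1, h2, hb, h3⟩
  constructor
  · rintro ⟨hn, K, rfl⟩
    obtain ⟨a, ha, b, hb, hab⟩ := hn
    rw [SimpleGraph.ConnectedComponent.mem_supp_iff] at ha hb
    have h1 : G.Adj a b :=
      ((hreach a b).1 (SimpleGraph.ConnectedComponent.exact (ha.trans hb.symm))).resolve_left hab
    have h2 := (hG _ _).1 h1
    refine ⟨b.pos, fun hc => not_isC_of_side_ne h2.1 h2.2.2.2 (h2.1 ▸ hc), ?_⟩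
    ext x
    rw [SimpleGraph.ConnectedComponent.mem_supp_iff, ← hb, SimpleGraph.ConnectedComponent.eq,
      hreach]
    exact hclass b h2.2.2.1 x
  · rintro ⟨p, hp, rfl⟩
    let b : Bool → Vertex.{u} L := fun r => ⟨p, s, r, fun h => (hp h).elim⟩
    refine ⟨⟨b true, ⟨rfl, rfl⟩, b false, ⟨rfl, rfl⟩, fun h => ?_⟩,
      G.connectedComponentMk (b true), ?_⟩
    · exact Bool.false_ne_true (congrArg side h).symm
    · ext x
      rw [SimpleGraph.ConnectedComponent.mem_supp_iff, SimpleGraph.ConnectedComponent.eq, hreach]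
      exact hclass (b true) rfl x

theorem isTangleTop_iff {A : Set (Vertex.{u} L)} :
    IsTangleTop A ↔ ∃ p, ¬ (L.get p).IsC ∧ A = tops p :=
  exists_supp_eq_iff fun _ _ => topGraph_adj

theorem isTangleBot_iff {A : Set (Vertex.{u} L)} :
    IsTangleBot A ↔ ∃ p, ¬ (L.get p).IsC ∧ A = bots p :=
  exists_supp_eq_iff fun _ _ => botGraph_adj

theorem lv_eq_of_eq {x y : Vertex.{u} L} (h : x.pos = y.pos) (h' : x.top = y.top) :
    x.lv = y.lv := by rw [lv, lv, h, h']

theorem isTangle_iff {A B : Set (Vertex.{u} L)} :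
    IsTangle A B ↔ ∃ p, ¬ (L.get p).IsC ∧ A = tops p ∧ B = bots p := by
  rw [IsTangle, isTangleTop_iff, isTangleBot_iff]
  constructor
  · rintro ⟨⟨p, hp, rfl⟩, ⟨q, hq, rfl⟩, a, ha, a', ha', b, hb, b', hb', h1, h2, -, -, h3, -⟩
    refine ⟨p, hp, rfl, ?_⟩
    by_contra hne
    have hpq : q ≠ p := fun h => hne (by rw [h])
    -- At different positions comparison depends only on level and position, which `b` and `b'`
    -- share; then `b < a` would give `b' < a`.
    have h4 : ¬ b' < a := fun h => h3.2 h.le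
    refine h4 ?_
    rw [lt_iff_of_pos_ne (by rw [hb'.1, ha.1]; exact hpq)]
    rw [lt_iff_of_pos_ne (by rw [hb.1, ha.1]; exact hpq)] at h1
    rwa [lv_eq_of_eq (hb'.1.trans hb.1.symm) (hb'.2.trans hb.2.symm), hb'.1, ← hb.1]
  · rintro ⟨p, hp, rfl, rfl⟩
    refine ⟨⟨p, hp, rfl⟩, ⟨p, hp, rfl⟩, ?_⟩
    let v : Bool → Bool → Vertex.{u} L := fun s r => ⟨p, s, r, fun h => (hp h).elim⟩
    have hlv : ∀ s r, (v s r).lv = (L.get p).idx + s.toNat := fun _ _ => rfl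
    have hlt : ∀ s r s' r', v s r < v s' r' ↔ s = false ∧ s' = true ∧ r = r' := by
      intro s r s' r'
      have h1 : (v s r).pos = (v s' r').pos := rfl
      have h2 : ∀ s r, (v s r).side = r := fun _ _ => rfl
      rw [lt_def, hlv, hlv, h1, h2, h2]
      cases s <;> cases s' <;> (simp; try omega)
    have hinc : ∀ s r s' r', r ≠ r' → IncompRel (· ≤ ·) (v s r) (v s' r') := by
      intro s r s' r' hr
      constructor
      · rintro (h | h)
        · exact hr (congrArg side h)
        · exact hr ((hlt _ _ _ _).1 h).2.2
      · rintro (h | h)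
        · exact hr (congrArg side h).symm
        · exact hr ((hlt _ _ _ _).1 h).2.2.symm
    exact ⟨v true true, ⟨rfl, rfl⟩, v true false, ⟨rfl, rfl⟩, v false true, ⟨rfl, rfl⟩,
      v false false, ⟨rfl, rfl⟩, (hlt _ _ _ _).2 ⟨rfl, rfl, rfl⟩, (hlt _ _ _ _).2 ⟨rfl, rfl, rfl⟩,
      hinc _ _ _ _ (by decide), hinc _ _ _ _ (by decide), hinc _ _ _ _ (by decide),
      hinc _ _ _ _ (by decide)⟩

theorem tops_union_bots (p : Fin L.length) :
    tops p ∪ bots p = {x : Vertex.{u} L | x.pos = p} := by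
  ext x
  cases h : x.top <;> simp [tops, bots, h]

theorem mem_outsideTangles {x : Vertex.{u} L} :
    x ∈ outsideTangles (Vertex.{u} L) ↔ (L.get x.pos).IsC := by
  constructor
  · intro h
    by_contra hc
    refine h _ _ (isTangle_iff.2 ⟨x.pos, hc, rfl, rfl⟩) ?_
    rw [tops_union_bots]
    rfl
  · intro hc A B hAB hx
    obtain ⟨p, hp, rfl, rfl⟩ := isTangle_iff.1 hAB
    rw [tops_union_bots] at hx
    exact hp (hx ▸ hc)

/-! ### The parts of the poset of a word -/

open Classical in
/-- The part at a position. -/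
noncomputable def part (p : Fin L.length) : Part (Vertex.{u} L) :=
  if (L.get p).IsC then .cloneSet {x | x.pos = p} else .tangle (tops p) (bots p)

theorem verts_part (p : Fin L.length) : (part p).verts = {x : Vertex.{u} L | x.pos = p} := by
  rw [part]
  split_ifs
  · rfl
  · exact tops_union_bots p

theorem part_injective : Function.Injective (part.{u} (L := L)) := by
  intro p q h
  obtain ⟨x, hx, -⟩ := exists_pos_lv.{u} p (Letter.idx_mem_levels _)
  have h1 : x ∈ (part p).verts := by rw [verts_part]; exact hx
  rw [h, verts_part] at h1
  exact hx.symm.trans h1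

theorem isPart_iff (hclone : ∀ x y : Vertex.{u} L, (L.get x.pos).IsC → (L.get y.pos).IsC →
    Clones x y → x.pos = y.pos) {Y : Part (Vertex.{u} L)} : Y.IsPart ↔ ∃ p, part p = Y := by
  have hcl : ∀ a : Vertex.{u} L, (L.get a.pos).IsC →
      {x | x ∈ outsideTangles (Vertex.{u} L) ∧ Clones x a} = {x | x.pos = a.pos} := by
    intro a ha
    ext x
    simp only [Set.mem_ofPred_eq, mem_outsideTangles]
    constructor
    · rintro ⟨hx, h⟩
      exact hclone x a hx ha h
    · intro h
      have hx : (L.get x.pos).IsC := h ▸ ha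
      refine ⟨hx, ?_⟩
      rw [ext' h ((x.ok hx).1.trans (a.ok ha).1.symm) ((x.ok hx).2.trans (a.ok ha).2.symm)]
      rfl
  constructor
  · intro h
    cases Y with
    | cloneSet C =>
      obtain ⟨a, ha, rfl⟩ := h
      rw [mem_outsideTangles] at ha
      refine ⟨a.pos, ?_⟩
      rw [part, if_pos ha, hcl a ha]
    | tangle A B =>
      obtain ⟨p, hp, rfl, rfl⟩ := isTangle_iff.1 h
      exact ⟨p, by rw [part, if_neg hp]⟩
  · rintro ⟨p, rfl⟩
    rw [part]
    split_ifs with hc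
    · obtain ⟨a, rfl, -⟩ := exists_pos_lv.{u} p (Letter.idx_mem_levels _)
      exact ⟨a, mem_outsideTangles.2 hc, (hcl a hc).symm⟩
    · exact isTangle_iff.2 ⟨p, hc, rfl, rfl⟩

theorem hasLetter_part (hlv : ∀ x : Vertex.{u} L, level x = x.lv) (p : Fin L.length) :
    HasLetter (part.{u} p) (L.get p) := by
  rw [part]
  have h1 : ∀ x : Vertex.{u} L, x.pos = p → level x = (L.get p).idx + x.top.toNat := by
    rintro x rfl
    exact hlv x
  have h2 : ∀ x : Vertex.{u} L, x.pos = p → (L.get p).IsC → x.top = false := by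
    rintro x rfl hc
    exact (x.ok hc).1
  generalize L.get p = l at h1 h2
  cases l with
  | c i =>
    rw [if_pos (show (Letter.c i).IsC from trivial)]
    intro a ha
    rw [h1 a ha, h2 a ha trivial]
    rfl
  | t i =>
    rw [if_neg (show ¬ (Letter.t i).IsC from id)]
    constructor
    · rintro b ⟨hb, hb'⟩
      rw [h1 b hb, hb']
      rfl
    · rintro b ⟨hb, hb'⟩
      rw [h1 b hb, hb']
      rfl

theorem isListingWord (hlv : ∀ x : Vertex.{u} L, level x = x.lv)
    (hclone : ∀ x y : Vertex.{u} L, (L.get x.pos).IsC → (L.get y.pos).IsC →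
      Clones x y → x.pos = y.pos) : IsListingWord (Vertex.{u} L) (FreeMonoid.ofList L) := by
  refine ⟨List.ofFn part, ⟨List.nodup_ofFn.2 part_injective, fun Y => ?_, ?_⟩, ?_⟩
  · rw [isPart_iff hclone, List.mem_ofFn]
  · intro i j hij a ha b hb
    rw [List.get_ofFn, verts_part] at ha hb
    have hne : a.pos ≠ b.pos := by
      rw [ha, hb]
      exact fun h => hij (Fin.cast_injective _ h)
    rw [lt_iff_of_pos_ne hne, hlv, hlv, ha, hb]
    rfl
  · rw [List.forall₂_iff_get]
    refine ⟨by simp, fun i h h' => ?_⟩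
    rw [List.get_ofFn]
    exact hasLetter_part hlv ⟨i, h'⟩

/-! ### Conditions (i) and (ii) control levels and clones. -/

theorem exists_lt_lv (hL : ∀ v l, trace L = trace (l :: v) → l.idx = 1) (x : Vertex.{u} L)
    (hx : 2 ≤ x.lv) : ∃ y < x, y.lv + 1 = x.lv := by
  cases ht : x.top with
  | true =>
    refine ⟨⟨x.pos, false, x.side, fun h => (not_isC_of_top ht h).elim⟩, ?_, ?_⟩
    · exact Or.inr ⟨by simp [lv, ht], Or.inr ⟨rfl, rfl⟩⟩
    · simp [lv, ht]
  | false =>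
    have hi : x.lv = (L.get x.pos).idx := by simp [lv, ht]
    by_contra hc
    have hd : L = L.take x.pos ++ L.get x.pos :: L.drop (x.pos + 1) := by simp
    -- An earlier letter occupying the level just below `x` would supply the missing predecessor.
    obtain ⟨l', v', hl', e⟩ := exists_trace_eq_cons (u := L.take x.pos) hi.le (by
      intro y hy k hk hkx
      obtain ⟨r, hr, rfl⟩ := List.mem_take_iff_getElem.1 hy
      have hr1 : r < L.length := by omega
      obtain ⟨z, hz, hzk⟩ := exists_pos_lv.{u} ⟨r, hr1⟩ hk
      refine hc ⟨z, Or.inr ⟨by omega, Or.inl ?_⟩, by omega⟩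
      rw [hz, Fin.lt_def]
      exact (lt_min_iff.1 hr).1) (L.drop (x.pos + 1))
    rw [← hd] at e
    have := hL _ _ e
    omega

/-- Clones have equal level. A vertex positioned between them on an adjacent level would be
comparable to exactly one of them, so no letter in between obstructs bringing the two equal `c`
letters together. -/
theorem pos_not_lt_of_clones
    (hL : ∀ v l, trace L = trace (l :: v) → l.idx = 1)
    (hcc : ∀ i u v, trace L ≠ trace (u ++ .c i :: .c i :: v)) {x y : Vertex.{u} L}
    (hx : (L.get x.pos).IsC) (hy : (L.get y.pos).IsC) (h : Clones x y) : ¬ x.pos < y.pos := by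
  intro hlt
  have hD : ∀ z, z < x ↔ z < y := fun z => Set.ext_iff.1 (congrArg Prod.fst h) z
  have hU : ∀ z, x < z ↔ y < z := fun z => not_iff_not.1 (Set.ext_iff.1 (congrArg Prod.snd h) z)
  have key : ∀ x y : Vertex.{u} L, (∀ z, z < x ↔ z < y) → ¬ x.lv < y.lv := by
    intro x y hD hl
    have := x.lv_pos
    obtain ⟨z, hz, hzl⟩ := exists_lt_lv hL y (by omega)
    have := lv_lt_of_lt ((hD z).2 hz)
    omega
  have hl : x.lv = y.lv :=
    le_antisymm (not_lt.1 (key y x fun z => (hD z).symm)) (not_lt.1 (key x y hD))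
  have hgc : ∀ z : Vertex.{u} L, (L.get z.pos).IsC → ∃ i : ℕ+, L.get z.pos = .c i ∧ z.lv = i := by
    intro z hz
    have h1 := (z.ok hz).1
    rw [lv, h1]
    generalize L.get z.pos = l at hz
    cases l with
    | c i => exact ⟨i, rfl, rfl⟩
    | t i => exact hz.elim
  obtain ⟨i, hi, hxi⟩ := hgc x hx
  obtain ⟨j, hj, hyj⟩ := hgc y hy
  have hij : j = i := PNat.coe_injective (hyj.symm.trans (hl.symm.trans hxi))
  subst hij
  have hxy : (x.pos : ℕ) < y.pos := hlt
  have hylen := y.pos.2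
  set mid := (L.drop (x.pos + 1)).take (y.pos - (x.pos + 1)) with hmid
  have hd : L = L.take x.pos ++ .c j :: (mid ++ .c j :: L.drop (y.pos + 1)) := by
    have e1 : L = L.take x.pos ++ L.get x.pos :: L.drop (x.pos + 1) := by simp
    have e2 : L.drop (y.pos : ℕ) = L.get y.pos :: L.drop (y.pos + 1) := by simp
    have e3 : L.drop (x.pos + 1) = mid ++ L.drop (y.pos : ℕ) := by
      rw [hmid]
      conv_lhs => rw [← List.take_append_drop (y.pos - (x.pos + 1)) (L.drop (x.pos + 1))]
      rw [List.drop_drop]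
      congr 2
      omega
    conv_lhs => rw [e1, e3, e2, hi, hj]
  obtain ⟨u', v', e⟩ := exists_trace_eq_append_cc (i := j) mid (L.drop (y.pos + 1)) (by
    intro l hlm k hk
    obtain ⟨r, hr, rfl⟩ := List.mem_take_iff_getElem.1 hlm
    rw [List.length_drop] at hr
    have hr' : x.pos + 1 + r < L.length := by omega
    rw [List.getElem_drop] at hk
    obtain ⟨z, hz, hzk⟩ := exists_pos_lv.{u} ⟨x.pos + 1 + r, hr'⟩ hk
    have hz1 : x.pos < z.pos := by
      rw [hz, Fin.lt_def]
      dsimp only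
      omega
    have hz2 : z.pos < y.pos := by
      rw [hz, Fin.lt_def]
      dsimp only
      omega
    constructor
    · intro hk1
      have h1 : z < x := (hD z).2 (Or.inr ⟨by omega, Or.inl hz2⟩)
      rw [lt_iff_of_pos_ne hz1.ne'] at h1
      rcases h1 with h1 | h1
      · omega
      · exact hz1.not_gt h1.2
    · intro hk1
      have h1 : y < z := (hU z).1 (Or.inr ⟨by omega, Or.inl hz1⟩)
      rw [lt_iff_of_pos_ne hz2.ne'] at h1
      rcases h1 with h1 | h1
      · omega
      · exact hz2.not_gt h1.2)
  refine hcc j (L.take x.pos ++ u') v' ?_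
  conv_lhs => rw [hd, trace_append, e, ← trace_append, ← List.append_assoc]

theorem isSkeleton (hL : ∀ v l, trace L = trace (l :: v) → l.idx = 1)
    (hcc : ∀ i u v, trace L ≠ trace (u ++ .c i :: .c i :: v)) :
    IsSkeleton (Vertex.{u} L) (trace L) := by
  have hw : IsListingWord (Vertex.{u} L) (FreeMonoid.ofList L) := by
    refine isListingWord (level_eq_of_rank lv lv_pos (fun _ _ => lv_lt_of_lt) (exists_lt_lv hL)) ?_
    intro x y hx hy h
    exact le_antisymm (not_lt.1 (pos_not_lt_of_clones hL hcc hy hx (Eq.symm h)))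
      (not_lt.1 (pos_not_lt_of_clones hL hcc hx hy h))
  intro w
  constructor
  · intro h
    exact hw.of_mk_eq (Eq.symm h)
  · intro h
    exact trace_eq_of_isListingWord h hw

end Vertex

/-! ### Translation between lists and words of the free monoid. -/

theorem exists_eq_of_mul_iff_idx {l : Letter} {w : List Letter} :
    (∃ v : FreeMonoid Letter, FreeMonoid.ofList (l :: w) = FreeMonoid.of (.c 1) * v ∨
      FreeMonoid.ofList (l :: w) = FreeMonoid.of (.t 1) * v) ↔ l.idx = 1 := by
  have h1 : ∀ (x : Letter) (v : FreeMonoid Letter),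
      FreeMonoid.ofList (l :: w) = FreeMonoid.of x * v ↔ l = x ∧ w = v.toList := by
    intro x v
    rw [← FreeMonoid.toList.injective.eq_iff]
    simp
  simp only [h1]
  constructor
  · rintro ⟨v, ⟨rfl, -⟩ | ⟨rfl, -⟩⟩ <;> rfl
  · intro h
    refine ⟨FreeMonoid.ofList w, ?_⟩
    cases l with
    | c i =>
      have : i = 1 := PNat.coe_injective h
      exact Or.inl ⟨by rw [this], rfl⟩
    | t i =>
      have : i = 1 := PNat.coe_injective h
      exact Or.inr ⟨by rw [this], rfl⟩

theorem mul_cc_mul_eq (i : ℕ+) (u v : List Letter) :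
    FreeMonoid.ofList u * (FreeMonoid.of (.c i) * FreeMonoid.of (.c i)) * FreeMonoid.ofList v =
      FreeMonoid.ofList (u ++ .c i :: .c i :: v) := by
  apply FreeMonoid.toList.injective
  simp

end Skeleta

theorem mainTheorem9 (m : Skeleta.M) :
    (∃ (P : Type u) (_ : PartialOrder P),
      Finite P ∧ Skeleta.ThreeOneFree P ∧ Skeleta.IsSkeleton P m) ↔
    (∀ w : FreeMonoid Skeleta.Letter, Skeleta.Represents w m → w ≠ 1 →
      ∃ v : FreeMonoid Skeleta.Letter,
        w = FreeMonoid.of (Skeleta.Letter.c 1) * v ∨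
        w = FreeMonoid.of (Skeleta.Letter.t 1) * v) ∧
    (∀ w : FreeMonoid Skeleta.Letter, Skeleta.Represents w m →
      ¬ ∃ (i : ℕ+) (u v : FreeMonoid Skeleta.Letter),
        w = u * (FreeMonoid.of (Skeleta.Letter.c i) * FreeMonoid.of (Skeleta.Letter.c i)) * v) := by
  constructor
  · rintro ⟨P, _, -, -, hP⟩
    constructor
    · intro w hw hne
      rw [hP w] at hw
      cases w using FreeMonoid.casesOn with
      | one => exact (hne rfl).elim
      | of_mul l w => exact Skeleta.exists_eq_of_mul_iff_idx.2 (Skeleta.IsListingWord.head hw)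
    · rintro w hw ⟨i, u, v, rfl⟩
      rw [hP] at hw
      exact Skeleta.IsListingWord.not_cc (Skeleta.mul_cc_mul_eq i u.toList v.toList ▸ hw)
  · rintro ⟨h1, h2⟩
    obtain ⟨w, hw⟩ := Quotient.exists_rep m
    have hm : Skeleta.trace w.toList = m := hw
    refine ⟨Skeleta.Vertex.{u} w.toList, inferInstance, inferInstance,
      Skeleta.Vertex.threeOneFree, ?_⟩
    rw [← hm]
    refine Skeleta.Vertex.isSkeleton (fun v l e => ?_) fun i u v e => ?_
    · refine Skeleta.exists_eq_of_mul_iff_idx.1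
        (h1 (FreeMonoid.ofList (l :: v)) (e.symm.trans hm) fun h => ?_)
      exact List.cons_ne_nil l v h
    · exact h2 (FreeMonoid.ofList (u ++ .c i :: .c i :: v)) (e.symm.trans hm)
        ⟨i, FreeMonoid.ofList u, FreeMonoid.ofList v, (Skeleta.mul_cc_mul_eq i u v).symm⟩
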